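/- **Notions.** For an infinite set $\mathbb P$ of propositional variables, modal formulas over $\mathbb P$ are built with $\neg,\wedge,\Box$ (with $\varphi\to\psi:=\neg(\varphi\wedge\neg\psi)$ and $\Diamond\varphi:=\neg\Box\neg\varphi$). $\mathsf{GL}(\mathbb P)$ is axiomatized by all propositional tautologies, $\Box(\varphi\to\psi)\to(\Box\varphi\to\Box\psi)$ and $\Box(\Box\varphi\to\varphi)\to\Box\varphi$, with the rules modus ponens and necessitation. A set $\Gamma$ of formulas is consistent if no contradiction follows in $\mathsf{GL}(\mathbb P)$ from finitely many members of $\Gamma$. In a topological model on a space $X$ the Boolean connectives are interpreted classically and $[\![\Diamond\varphi]\!]=d[\![\varphi]\!]$ is the set of limit points of $[\![\varphi]\!]$. $\Gamma$ is satisfiable on $X$ if for some valuation there is a point of $X$ at which all members of $\Gamma$ are true. $\mathsf{GL}(\mathbb P)$ is strongly complete with respect to a class of spaces if every consistent set of formulas is satisfiable on some space of the class. For an ordinal $x\neq 0$ let $\ell(x)$ be the unique $\beta$ with $x=\alpha+\omega^\beta$ for some $\alpha$, and let $\ell(0)=0$. The hyperlogarithms $(\ell^\xi)_{\xi\in\mathrm{Ord}}$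 are the unique family of initial functions on the ordinals (functions mapping initial segments onto initial segments) such that $\ell^1=\ell$, $\ell^{\alpha+\beta}=\ell^\beta\circ\ell^\alpha$, and, for each $\zeta$, $\ell^\zeta$ is pointwise at least $f^\zeta$ for every family $(f^\xi)$ of initial functions with these two properties that satisfies $f^\xi=\ell^\xi$ for all $\xi<\zeta$. Let $(X,\tau)$ be a scattered space, let $\rho_\tau x$ be the Cantor–Bendixson rank of $x$, i.e. the least $\xi$ with $x\notin d^{\xi+1}X$, and let $\rho_\tau X=\sup_{x\in X}(\rho_\tau x+1)$. For an ordinal $\lambda$, the generalized Icard topology $\tau_{+\lambda}$ is the least topology containing $\tau$ and all sets $\{x\in X:\alpha<\ell^\xi\rho_\tau x\le\beta\}$ with $-1\le\alpha<\beta\le\rho_\tau X$ and $\xi<\lambda$. On an ordinal $\Theta=\{\alpha:\alpha<\Theta\}$ let $\mathcal I_0$ be the topology generated by the sets $[0,\beta]$ and let $\mathcal I_\lambda=(\mathcal I_0)_{+\lambda}$. Let $\tau_c$ be the club topology: points of cofinality $\le\omega$ are isolated, and the neighbourhoods of a point $\alpha$ with $\mathrm{cf}(\alpha)>\omega$ are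 the sets that contain $\alpha$ and a closed unbounded subset of $\alpha$. **Theorem.** Let $\lambda$ be any ordinal and $\kappa=|\lambda|+\aleph_0$. Let $\mathbb P=\{p_i: i<(2^\kappa)^+\}$ be a set of propositional variables with $|\mathbb P|=(2^\kappa)^+$ (the $p_i$ being distinct), and let $$\Gamma=\{\Diamond p_i : i<(2^\kappa)^+\}\cup\{\Box(p_i\to\Diamond p_j) : i<j<(2^\kappa)^+\}.$$ Then $\Gamma$ is consistent, but for no ordinal $\Theta$ is $\Gamma$ satisfiable on $(\Theta,\mathcal I_\lambda)$ or on $(\Theta,(\tau_c)_{+\lambda})$. Consequently $\mathsf{GL}(\mathbb P)$ is not strongly complete with respect to any class of spaces of the form $(\Theta,\mathcal I_\lambda)$ or $(\Theta,(\tau_c)_{+\lambda})$, in particular with respect to any single such space. -/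

import Mathlib

universe u v w

open Ordinal Cardinal

/-- The end logarithm `ℓ`: for `x ≠ 0`, the unique `b` such that `x = a + ω ^ b` for some `a`;
and `ℓ 0 = 0` (the infimum of the empty set). -/
noncomputable def endLog (x : Ordinal.{u}) : Ordinal.{u} :=
  sInf {b | ∃ a, x = a + ω ^ b}

/-- Initial functions: they map initial segments of the ordinals onto initial segments. -/
def IsInitialFun (f : Ordinal.{u} → Ordinal.{u}) : Prop :=
  ∀ a, ∃ b, f '' Set.Iio a = Set.Iio b

/-- Families of initial functions that iterate `ℓ` additively in the exponent. -/
structure IsLogFamily (g : Ordinal.{u} → Ordinal.{u} → Ordinal.{u}) : Prop where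
  initial : ∀ ξ, IsInitialFun (g ξ)
  one : g 1 = endLog
  add : ∀ a b, g (a + b) = g b ∘ g a

/-- The hyperlogarithms: the maximal such family. Maximality is taken stage by stage: `L ζ` is
pointwise maximal among the possible continuations of `(L ξ)_{ξ < ζ}`.  (It only has content
at additively indecomposable `ζ > 1`, the other stages being forced by additivity.  A family that
is pointwise maximal at all stages simultaneously does not exist, as the functions involved are
not monotone.) -/
structure IsHyperlog (L : Ordinal.{u} → Ordinal.{u} → Ordinal.{u}) : Prop
    extends IsLogFamily L where
  maximal : ∀ (ζ : Ordinal.{u}) (g : Ordinal.{u} → Ordinal.{u} → Ordinal.{u}), IsLogFamily g →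
    (∀ ξ < ζ, g ξ = L ξ) → ∀ α, g ζ α ≤ L ζ α

theorem isInitialFun_iff {f : Ordinal.{u} → Ordinal.{u}} :
    IsInitialFun f ↔ ∀ a, ∀ d < f a, ∃ b < a, f b = d := by
  constructor
  · intro hf a d hd
    obtain ⟨b, hb⟩ := hf (a + 1)
    obtain ⟨c, hc⟩ := hf a
    have h1 : f a ∈ Set.Iio b := hb ▸ ⟨a, by simp, rfl⟩
    have h2 : d ∈ f '' Set.Iio (a + 1) := hb ▸ (hd.trans h1)
    obtain ⟨e, he, rfl⟩ := h2
    have he' : e ≤ a := by simpa using he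
    rcases he'.lt_or_eq with h | rfl
    · exact ⟨e, h, rfl⟩
    · exact absurd hd (lt_irrefl _)
  · intro hf a
    have hne : ∃ b, b ∉ f '' Set.Iio a := by
      by_contra h
      push Not at h
      obtain ⟨c, hc⟩ := (bddAbove_of_small : BddAbove (f '' Set.Iio a))
      exact absurd (hc (h (c + 1))) (by simp)
    refine ⟨sInf {b | b ∉ f '' Set.Iio a}, ?_⟩
    ext d
    constructor
    · rintro ⟨e, he, rfl⟩
      by_contra h
      have h : sInf {b | b ∉ f '' Set.Iio a} ≤ f e := not_lt.1 h
      have hm := csInf_mem (s := {b | b ∉ f '' Set.Iio a}) hne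
      rcases h.lt_or_eq with h | h
      · obtain ⟨b, hb, hb'⟩ := hf e _ h
        exact hm ⟨b, hb.trans he, hb'⟩
      · exact hm ⟨e, he, h.symm⟩
    · intro h
      by_contra h'
      exact notMem_of_lt_csInf (s := {b | b ∉ f '' Set.Iio a}) h (OrderBot.bddBelow _) h'

theorem IsInitialFun.le {f : Ordinal.{u} → Ordinal.{u}} (hf : IsInitialFun f) (a : Ordinal.{u}) :
    f a ≤ a := by
  induction a using WellFoundedLT.induction with
  | _ a ih =>
    by_contra h
    obtain ⟨b, hb, hb'⟩ := isInitialFun_iff.1 hf a a (not_le.1 h)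
    exact absurd (ih b hb) (by simpa [hb'] using hb)

theorem exists_eq_add_opow {x : Ordinal.{u}} (hx : x ≠ 0) : ∃ b a : Ordinal.{u}, x = a + ω ^ b := by
  induction x using WellFoundedLT.induction with
  | _ x ih =>
    by_cases hp : IsPrincipal (· + ·) x
    · rcases isPrincipal_add_iff_zero_or_omega0_opow.1 hp with h | ⟨b, rfl⟩
      · exact absurd h hx
      · exact ⟨b, 0, by simp⟩
    · obtain ⟨b, hb, c, hc, rfl⟩ := exists_lt_add_of_not_isPrincipal_add hp
      have hc0 : c ≠ 0 := by
        rintro rfl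
        simp at hb
      obtain ⟨e, a, rfl⟩ := ih c hc hc0
      exact ⟨e, b + a, by rw [add_assoc]⟩

theorem endLog_spec {x : Ordinal.{u}} (hx : x ≠ 0) : ∃ a, x = a + ω ^ endLog x :=
  csInf_mem (s := {b | ∃ a, x = a + ω ^ b}) (exists_eq_add_opow hx)

theorem endLog_zero : endLog (0 : Ordinal.{u}) = 0 := by
  have : {b : Ordinal.{u} | ∃ a, (0 : Ordinal.{u}) = a + ω ^ b} = ∅ := by
    ext b
    simp only [Set.mem_ofPred_eq, Set.mem_empty_iff_false, iff_false, not_exists]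
    intro a h
    have : (0 : Ordinal.{u}) < ω ^ b := opow_pos _ omega0_pos
    exact absurd h.symm (this.trans_le le_add_self).ne'
  rw [endLog, this, Ordinal.sInf_empty]

/-- The exponent of the last term is unique. -/
theorem endLog_add_opow (a b : Ordinal.{u}) : endLog (a + ω ^ b) = b := by
  have key : ∀ a b a' b' : Ordinal.{u}, a + ω ^ b = a' + ω ^ b' → ¬ b < b' := by
    intro a b a' b' h hlt
    have h0 : (0 : Ordinal.{u}) < ω ^ b := opow_pos _ omega0_pos
    have hbb : (ω : Ordinal.{u}) ^ b < ω ^ b' := (opow_lt_opow_iff_right one_lt_omega0).2 hlt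
    have h1 : a < a' + ω ^ b' := h ▸ (lt_add_iff_pos_right a).2 h0
    rcases lt_or_ge a a' with h2 | h2
    · have := add_lt_add_of_le_of_lt h2.le hbb
      exact absurd h this.ne
    · obtain ⟨c, rfl⟩ : ∃ c, a = a' + c := ⟨a - a', (Ordinal.add_sub_cancel_of_le h2).symm⟩
      have hc : c < ω ^ b' := (add_lt_add_iff_left a').1 h1
      have := isPrincipal_add_omega0_opow b' hc hbb
      rw [add_assoc] at h
      exact absurd (add_left_cancel h) this.ne
  have h0 : (0 : Ordinal.{u}) < ω ^ b := opow_pos _ omega0_pos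
  obtain ⟨a', h⟩ := endLog_spec (x := a + ω ^ b) (h0.trans_le le_add_self).ne'
  exact le_antisymm (not_lt.1 (key _ _ _ _ h)) (not_lt.1 (key _ _ _ _ h.symm))

theorem isInitialFun_endLog : IsInitialFun endLog.{u} := by
  rw [isInitialFun_iff]
  intro a d hd
  have ha : a ≠ 0 := by
    rintro rfl
    rw [endLog_zero] at hd
    exact absurd hd (not_lt_bot)
  obtain ⟨c, hc⟩ := endLog_spec ha
  refine ⟨ω ^ d, ?_, by simpa using endLog_add_opow 0 d⟩
  calc ω ^ d < ω ^ endLog a := (opow_lt_opow_iff_right one_lt_omega0).2 hd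
    _ ≤ c + ω ^ endLog a := le_add_self
    _ = a := hc.symm

/-- One stage of the recursion: the value that a first drop below `α` at exponent `ξ` would
have, `F β` being the values already known for `β < α`. -/
noncomputable def hyperlogDrop (α : Ordinal.{u}) (F : ∀ β < α, Ordinal.{u} → Ordinal.{u})
    (ξ : Ordinal.{u}) : Ordinal.{u} :=
  open Classical in
  if ξ = 1 then endLog α
  else if 1 < ξ ∧ IsPrincipal (· + ·) ξ then ⨆ β : Set.Iio α, (F β.1 β.2 ξ + 1)
  else α

theorem exists_hyperlog_recursion : ∃ L : Ordinal.{u} → Ordinal.{u} → Ordinal.{u}, ∀ α,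
    (∀ η, hyperlogDrop α (fun β _ ξ => L ξ β) η < α →
      (∀ ξ < η, ¬ hyperlogDrop α (fun β _ ξ => L ξ β) ξ < α) →
      (∀ ξ < η, L ξ α = α) ∧
        ∀ ξ, L (η + ξ) α = L ξ (hyperlogDrop α (fun β _ ξ => L ξ β) η)) ∧
    ((∀ η, ¬ hyperlogDrop α (fun β _ ξ => L ξ β) η < α) → ∀ ξ, L ξ α = α) := by
  classical
  let step : ∀ α : Ordinal.{u}, (∀ β < α, Ordinal.{u} → Ordinal.{u}) → Ordinal.{u} → Ordinal.{u} :=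
    fun α F ξ =>
      if h : ∃ η, hyperlogDrop α F η < α then
        if ξ < sInf {η | hyperlogDrop α F η < α} then α
        else F (hyperlogDrop α F (sInf {η | hyperlogDrop α F η < α}))
          (csInf_mem (s := {η | hyperlogDrop α F η < α}) h)
          (ξ - sInf {η | hyperlogDrop α F η < α})
      else α
  let M : Ordinal.{u} → Ordinal.{u} → Ordinal.{u} := WellFoundedLT.fix step
  have hM : ∀ α, M α = step α (fun β _ => M β) := fun α => WellFoundedLT.fix_eq step α
  refine ⟨fun ξ α => M α ξ, fun α => ⟨fun η hη hmin => ?_, fun hno ξ => ?_⟩⟩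
  · change hyperlogDrop α (fun β _ => M β) η < α at hη
    change ∀ ξ < η, ¬ hyperlogDrop α (fun β _ => M β) ξ < α at hmin
    have he : sInf {η | hyperlogDrop α (fun β _ => M β) η < α} = η := by
      refine le_antisymm (csInf_le' hη) (le_csInf ⟨η, hη⟩ fun ξ hξ => ?_)
      by_contra h
      exact hmin ξ (not_le.1 h) hξ
    constructor
    · intro ξ hξ
      change M α ξ = α
      rw [hM]
      simp only [step]
      rw [dif_pos ⟨η, hη⟩, if_pos (he.symm ▸ hξ)]
    · intro ξ
      change M α (η + ξ) = M (hyperlogDrop α (fun β _ => M β) η) ξ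
      rw [hM α]
      simp only [step]
      rw [dif_pos ⟨η, hη⟩, if_neg (by rw [he]; simp)]
      simp only [he]
      rw [Ordinal.add_sub_cancel]
  · change M α ξ = α
    rw [hM]
    simp only [step]
    rw [dif_neg]
    rintro ⟨η, hη⟩
    exact hno η hη

theorem exists_isHyperlog : ∃ L : Ordinal.{u} → Ordinal.{u} → Ordinal.{u}, IsHyperlog L := by
  obtain ⟨L, hL⟩ := exists_hyperlog_recursion.{u}
  set T : Ordinal.{u} → Ordinal.{u} → Ordinal.{u} :=
    fun α => hyperlogDrop α (fun β _ ξ => L ξ β) with hT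
  have hT1 : ∀ α, T α 1 = endLog α := fun α => by simp [hT, hyperlogDrop]
  have hTp : ∀ α ξ, 1 < ξ → IsPrincipal (· + ·) ξ → T α ξ = ⨆ β : Set.Iio α, (L ξ β + 1) :=
    fun α ξ h1 h2 => by simp [hT, hyperlogDrop, h1, h1.ne', h2]
  have hTlt : ∀ α ξ, T α ξ < α → ξ = 1 ∨ (1 < ξ ∧ IsPrincipal (· + ·) ξ) := by
    intro α ξ h
    by_contra h'
    push Not at h'
    simp only [hT, hyperlogDrop] at h
    rw [if_neg h'.1, if_neg (by simpa using h'.2)] at h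
    exact lt_irrefl _ h
  -- case distinction: either a first drop exists, or everything is fixed
  have cases : ∀ α, (∃ η, T α η < α ∧ IsPrincipal (· + ·) η ∧ 0 < η ∧ (∀ ξ < η, ¬ T α ξ < α) ∧
      (∀ ξ < η, L ξ α = α) ∧ ∀ ξ, L (η + ξ) α = L ξ (T α η)) ∨
      ((∀ η, ¬ T α η < α) ∧ ∀ ξ, L ξ α = α) := by
    intro α
    by_cases h : ∃ η, T α η < α
    · left
      have h1 := csInf_mem (s := {η | T α η < α}) h
      have h2 : ∀ ξ < sInf {η | T α η < α}, ¬ T α ξ < α := fun ξ hξ h' =>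
        notMem_of_lt_csInf hξ (OrderBot.bddBelow _) h'
      obtain ⟨h3, h4⟩ := (hL α).1 _ h1 h2
      refine ⟨_, h1, ?_, ?_, h2, h3, h4⟩
      · rcases hTlt _ _ h1 with h | h
        · rw [h]; exact isPrincipal_add_one
        · exact h.2
      · rcases hTlt _ _ h1 with h | h
        · rw [h]; exact one_pos
        · exact one_pos.trans h.1
    · right
      push Not at h
      exact ⟨fun η => not_lt.2 (h η), (hL α).2 fun η => not_lt.2 (h η)⟩
  have zero : ∀ α, L 0 α = α := by
    intro α
    rcases cases α with ⟨η, -, -, h0, -, h, -⟩ | ⟨-, h⟩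
    · exact h 0 h0
    · exact h 0
  have le : ∀ α ξ, L ξ α ≤ α := by
    intro α
    induction α using WellFoundedLT.induction with
    | _ α ih =>
      intro ξ
      rcases cases α with ⟨η, hη, -, -, -, h1, h2⟩ | ⟨-, h⟩
      · rcases lt_or_ge ξ η with h | h
        · exact (h1 ξ h).le
        · rw [← Ordinal.add_sub_cancel_of_le h, h2]
          exact (ih _ hη _).trans hη.le
      · exact (h ξ).le
  have one : L 1 = endLog := by
    funext α
    rcases cases α with ⟨η, hη, -, h0, hmin, h1, h2⟩ | ⟨hno, h⟩
    · rcases hTlt _ _ hη with rfl | h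
      · have := h2 0
        rw [add_zero, zero, hT1] at this
        exact this
      · rw [h1 1 h.1]
        have := hmin 1 h.1
        rw [hT1] at this
        exact le_antisymm (not_lt.1 this) (isInitialFun_endLog.le α)
    · rw [h 1]
      have := hno 1
      rw [hT1] at this
      exact le_antisymm (not_lt.1 this) (isInitialFun_endLog.le α)
  have add : ∀ α a b, L (a + b) α = L b (L a α) := by
    intro α
    induction α using WellFoundedLT.induction with
    | _ α ih =>
      intro a b
      rcases cases α with ⟨η, hη, hp, -, -, h1, h2⟩ | ⟨-, h⟩
      · rcases lt_or_ge a η with ha | ha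
        · rw [h1 a ha]
          rcases lt_or_ge b η with hb | hb
          · rw [h1 b hb, h1 _ (hp ha hb)]
          · rw [hp.add_eq_right_of_le ha hb]
        · rw [← Ordinal.add_sub_cancel_of_le ha, add_assoc, h2, h2, ih _ hη]
      · rw [h a, h, h]
  have sup_ge : ∀ α ξ, 1 < ξ → IsPrincipal (· + ·) ξ → T α ξ ≤ α := by
    intro α ξ h1 h2
    rw [hTp α ξ h1 h2]
    exact Ordinal.iSup_le fun β => Order.add_one_le_of_lt ((le _ _).trans_lt β.2)
  -- the three possible values at a principal exponent
  have princ : ∀ α ξ, 1 < ξ → IsPrincipal (· + ·) ξ →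
      (∃ η < ξ, L η α < α ∧ η + ξ = ξ ∧ L ξ α = L ξ (L η α)) ∨
      L ξ α = ⨆ β : Set.Iio α, (L ξ β + 1) := by
    intro α ξ hξ1 hξp
    rcases cases α with ⟨η, hη, hp, h0, hmin, h1, h2⟩ | ⟨hno, h⟩
    · rcases lt_trichotomy η ξ with h | rfl | h
      · left
        have e : L η α = T α η := by simpa [zero] using h2 0
        refine ⟨η, h, e ▸ hη, hξp.add_eq_right h, ?_⟩
        rw [e, ← h2, hξp.add_eq_right h]
      · right
        rw [← hTp α _ hξ1 hξp]
        simpa [zero] using h2 0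
      · right
        rw [← hTp α _ hξ1 hξp, h1 ξ h]
        exact le_antisymm (not_lt.1 (hmin ξ h)) (sup_ge _ _ hξ1 hξp)
    · right
      rw [← hTp α _ hξ1 hξp, h ξ]
      exact le_antisymm (not_lt.1 (hno ξ)) (sup_ge _ _ hξ1 hξp)
  have small : ∀ ξ : Ordinal.{u}, ¬ 1 < ξ → ξ = 0 ∨ ξ = 1 := fun ξ h => Order.le_one_iff.1 (not_lt.1 h)
  have init : ∀ ξ α, ∀ δ < L ξ α, ∃ β < α, L ξ β = δ := by
    intro ξ
    induction ξ using WellFoundedLT.induction with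
    | _ ξ ihξ =>
      by_cases hp : IsPrincipal (· + ·) ξ
      · by_cases hξ1 : 1 < ξ
        · intro α
          induction α using WellFoundedLT.induction with
          | _ α ih =>
            intro δ hδ
            rcases princ α ξ hξ1 hp with ⟨η, -, hlt, -, he⟩ | he
            · rw [he] at hδ
              obtain ⟨β, hβ, rfl⟩ := ih _ hlt δ hδ
              exact ⟨β, hβ.trans hlt, rfl⟩
            · rw [he, Ordinal.lt_iSup_iff] at hδ
              obtain ⟨β, hβ⟩ := hδ
              rcases (Order.lt_add_one_iff.1 hβ).lt_or_eq with h | h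
              · obtain ⟨β', hβ', rfl⟩ := ih β.1 β.2 δ h
                exact ⟨β', hβ'.trans β.2, rfl⟩
              · exact ⟨β.1, β.2, h.symm⟩
        · rcases small ξ hξ1 with rfl | rfl
          · intro α δ hδ
            rw [zero] at hδ
            exact ⟨δ, hδ, zero δ⟩
          · rw [one]
            exact isInitialFun_iff.1 isInitialFun_endLog
      · obtain ⟨b, hb, c, hc, rfl⟩ := exists_lt_add_of_not_isPrincipal_add hp
        intro α δ hδ
        rw [add] at hδ
        obtain ⟨γ, hγ, rfl⟩ := ihξ c hc _ _ hδ
        obtain ⟨β, hβ, rfl⟩ := ihξ b hb _ _ hγ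
        exact ⟨β, hβ, add _ _ _⟩
  refine ⟨L, ⟨⟨fun ξ => isInitialFun_iff.2 (init ξ), one, fun a b => funext fun α => add α a b⟩,
    ?_⟩⟩
  intro ζ g hg hgL
  by_cases hp : IsPrincipal (· + ·) ζ
  · by_cases hζ1 : 1 < ζ
    · intro α
      induction α using WellFoundedLT.induction with
      | _ α ih =>
        rcases princ α ζ hζ1 hp with ⟨η, hη, hlt, hab, he⟩ | he
        · rw [he]
          calc g ζ α = g (η + ζ) α := by rw [hab]
            _ = g ζ (L η α) := by rw [hg.add, Function.comp, hgL η hη]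
            _ ≤ _ := ih _ hlt
        · rw [he]
          by_contra h
          obtain ⟨β, hβ, hβ'⟩ := isInitialFun_iff.1 (hg.initial ζ) α _ (not_le.1 h)
          have h1 := ih β hβ
          rw [hβ'] at h1
          have h2 := Ordinal.le_iSup (fun β : Set.Iio α => L ζ β + 1) ⟨β, hβ⟩
          exact absurd (Order.lt_add_one_iff.2 le_rfl) (not_lt.2 (h2.trans h1))
    · intro α
      rcases small ζ hζ1 with rfl | rfl
      · rw [zero]
        exact (hg.initial 0).le α
      · rw [hg.one, one]
  · obtain ⟨b, hb, c, hc, rfl⟩ := exists_lt_add_of_not_isPrincipal_add hp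
    intro α
    rw [hg.add, add, Function.comp, hgL b hb, hgL c hc]

/-- There is exactly one family of hyperlogarithms. -/
theorem existsUnique_isHyperlog :
    ∃! L : Ordinal.{u} → Ordinal.{u} → Ordinal.{u}, IsHyperlog L := by
  obtain ⟨L, hL⟩ := exists_isHyperlog.{u}
  refine ⟨L, hL, fun M hM => ?_⟩
  funext ζ
  induction ζ using WellFoundedLT.induction with
  | _ ζ ih =>
    funext α
    exact le_antisymm (hL.maximal ζ M hM.toIsLogFamily ih α)
      (hM.maximal ζ L hL.toIsLogFamily (fun ξ hξ => (ih ξ hξ).symm) α)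

/-- The hyperlogarithms `hyperlog ξ = ℓ^ξ`. -/
noncomputable def hyperlog : Ordinal.{u} → Ordinal.{u} → Ordinal.{u} :=
  existsUnique_isHyperlog.choose

theorem isHyperlog_hyperlog : IsHyperlog hyperlog.{u} :=
  existsUnique_isHyperlog.choose_spec.1

/-! ### Ranks, generalized Icard topologies, and topologies on ordinals -/

/-- The transfinite iteration `d^ξ A` of the derived set operator of `τ`. -/
noncomputable def iterDerived {X : Type v} (τ : TopologicalSpace X) (A : Set X)
    (ξ : Ordinal.{u}) : Set X :=
  Ordinal.limitRecOn ξ A (fun _ D => @derivedSet X τ D) (fun o _ D => ⋂ η : Set.Iio o, D η.1 η.2)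

/-- The rank of a point: the least `ξ` with `x ∉ d^{ξ+1} X`. -/
noncomputable def pointRank {X : Type v} (τ : TopologicalSpace X) (x : X) : Ordinal.{u} :=
  sInf {ξ | x ∉ iterDerived τ Set.univ (ξ + 1)}

/-- The rank of a scattered space: the supremum of all `ρ x + 1`. -/
noncomputable def spaceRank {X : Type v} (τ : TopologicalSpace X) : Ordinal.{u} :=
  ⨆ x, (pointRank τ x + 1)

/-- The set `(a, b]_ξ = {x | a < ℓ^ξ (ρ x) ≤ b}`; here `a = ⊥` plays the role of `-1`. -/
def icardInterval {X : Type v} (τ : TopologicalSpace X) (ξ : Ordinal.{u})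
    (a : WithBot Ordinal.{u}) (b : Ordinal.{u}) : Set X :=
  {x | a < (hyperlog ξ (pointRank τ x) : WithBot Ordinal.{u}) ∧ hyperlog ξ (pointRank τ x) ≤ b}

/-- The generalized Icard topology `τ_{+lam}` of a scattered topology `τ`: the least topology
containing `τ` and all sets `(a, b]_ξ` with `-1 ≤ a < b ≤ ρ X` and `ξ < lam`. -/
@[reducible] def genIcard {X : Type v} (τ : TopologicalSpace X) (lam : Ordinal.{u}) : TopologicalSpace X :=
  TopologicalSpace.generateFrom
    ({U | @IsOpen X τ U} ∪
      {U | ∃ ξ < lam, ∃ (a : WithBot Ordinal.{u}) (b : Ordinal.{u}),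
        a < (b : WithBot Ordinal.{u}) ∧ b ≤ spaceRank τ ∧ U = icardInterval τ ξ a b})

/-- The left topology `I_0` on the ordinal `Θ`, generated by the sets `[0, b]`. -/
@[reducible] def leftTopology (Θ : Ordinal.{u}) : TopologicalSpace (Set.Iio Θ) :=
  TopologicalSpace.generateFrom {U | ∃ b : Set.Iio Θ, U = {x | x ≤ b}}

/-- The topology `I_lam = (I_0)_{+lam}` on the ordinal `Θ`. -/
@[reducible] def icardTopology (Θ lam : Ordinal.{u}) : TopologicalSpace (Set.Iio Θ) :=
  genIcard (leftTopology Θ) lam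

/-- `U` contains a club of `α`. -/
def ContainsClub {Θ : Ordinal.{u}} (U : Set (Set.Iio Θ)) (α : Set.Iio Θ) : Prop :=
  ∃ C : Set (Set.Iio α.1), IsClub C ∧ ∀ (γ : Set.Iio Θ) (h : γ.1 < α.1), ⟨γ.1, h⟩ ∈ C → γ ∈ U

/-- The club topology on the ordinal `Θ`: points of countable cofinality (including `0` and
successors) are isolated, and the neighbourhoods of a point `α` of uncountable cofinality are
the sets that contain `α` and a club of `α`. -/
@[reducible] def clubTopology (Θ : Ordinal.{u}) : TopologicalSpace (Set.Iio Θ) where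
  IsOpen U := ∀ α ∈ U, ℵ₀ < Ordinal.cof α.1 → ContainsClub U α
  isOpen_univ := fun α _ _ => ⟨Set.univ, IsClub.univ, fun _ _ _ => trivial⟩
  isOpen_inter := by
    intro U V hU hV α hα hc
    obtain ⟨C, hC, hCU⟩ := hU α hα.1 hc
    obtain ⟨D, hD, hDV⟩ := hV α hα.2 hc
    refine ⟨C ∩ D, IsClub.inter ?_ hC hD, fun γ h hγ => ⟨hCU γ h hγ.1, hDV γ h hγ.2⟩⟩
    rw [Ordinal.cof_Iio, ← Ordinal.lift_cof]
    intro h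
    exact hc.ne' (Cardinal.lift_eq_aleph0.1 h)
  isOpen_sUnion := by
    intro S hS α hα hc
    obtain ⟨U, hU, hαU⟩ := hα
    obtain ⟨C, hC, hCU⟩ := hS U hU α hαU hc
    exact ⟨C, hC, fun γ h hγ => ⟨U, hU, hCU γ h hγ⟩⟩

/-! ### Provability logic -/

/-- Modal formulas over the set `P` of propositional variables. -/
inductive ModalFormula (P : Type v) : Type v
  | var : P → ModalFormula P
  | neg : ModalFormula P → ModalFormula P
  | and : ModalFormula P → ModalFormula P → ModalFormula P
  | box : ModalFormula P → ModalFormula P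

namespace ModalFormula

variable {P : Type v}

/-- `φ → ψ` is `¬ (φ ∧ ¬ ψ)`. -/
def imp (φ ψ : ModalFormula P) : ModalFormula P := neg (and φ (neg ψ))

/-- `◇ φ` is `¬ □ ¬ φ`. -/
def dia (φ : ModalFormula P) : ModalFormula P := neg (box (neg φ))

/-- Propositional tautologies: true under every assignment of truth values to formulas that
respects the Boolean connectives. -/
def IsTautology (φ : ModalFormula P) : Prop :=
  ∀ t : ModalFormula P → Prop, (∀ ψ, t (neg ψ) ↔ ¬ t ψ) →
    (∀ ψ χ, t (and ψ χ) ↔ t ψ ∧ t χ) → t φ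

/-- Theorems of `GL(P)`. -/
inductive GLProvable : ModalFormula P → Prop
  | taut (φ : ModalFormula P) : IsTautology φ → GLProvable φ
  | axK (φ ψ : ModalFormula P) : GLProvable (imp (box (imp φ ψ)) (imp (box φ) (box ψ)))
  | axLob (φ : ModalFormula P) : GLProvable (imp (box (imp (box φ) φ)) (box φ))
  | mp (φ ψ : ModalFormula P) : GLProvable (imp φ ψ) → GLProvable φ → GLProvable ψ
  | nec (φ : ModalFormula P) : GLProvable φ → GLProvable (box φ)

/-- `φ` is derivable in `GL(P)` from the premises `Γ`: some implication
`γ₁ → (γ₂ → ⋯ → φ)` with `γ₁, γ₂, … ∈ Γ` is a theorem. -/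
def Derives (Γ : Set (ModalFormula P)) (φ : ModalFormula P) : Prop :=
  ∃ l : List (ModalFormula P), (∀ γ ∈ l, γ ∈ Γ) ∧ GLProvable (l.foldr imp φ)

/-- `Γ` is consistent with `GL(P)`: no contradiction is derivable from it. -/
def Consistent (Γ : Set (ModalFormula P)) : Prop :=
  ¬ ∃ φ, Derives Γ φ ∧ Derives Γ (neg φ)

/-- The set of points of the topological model `(X, τ, V)` at which a formula is true. -/
def truthSet {X : Type w} (τ : TopologicalSpace X) (V : P → Set X) : ModalFormula P → Set X
  | var p => V p
  | neg φ => (truthSet τ V φ)ᶜ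
  | and φ ψ => truthSet τ V φ ∩ truthSet τ V ψ
  | box φ => (@derivedSet X τ (truthSet τ V φ)ᶜ)ᶜ

theorem truthSet_dia {X : Type w} (τ : TopologicalSpace X) (V : P → Set X)
    (φ : ModalFormula P) : truthSet τ V (dia φ) = @derivedSet X τ (truthSet τ V φ) := by
  simp [dia, truthSet]

/-- `Γ` has a model at some point of the space `(X, τ)`. -/
def SatisfiableOn {X : Type w} (τ : TopologicalSpace X) (Γ : Set (ModalFormula P)) : Prop :=
  ∃ (V : P → Set X) (x : X), ∀ φ ∈ Γ, x ∈ truthSet τ V φ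

/-- `GL(P)` is strongly complete with respect to the class `K` of spaces: every consistent set of
formulas is satisfiable on a space in `K`. -/
def StronglyComplete (P : Type v) (K : Set (Σ X : Type w, TopologicalSpace X)) : Prop :=
  ∀ Γ : Set (ModalFormula P), Consistent Γ → ∃ S ∈ K, SatisfiableOn S.2 Γ

/-- The set `{◇ p_i} ∪ {□ (p_i → ◇ p_j) : i < j}`. -/
def chainSet {I : Type w} [LT I] (p : I → P) : Set (ModalFormula P) :=
  {φ | ∃ i, φ = dia (var (p i))} ∪
    {φ | ∃ i j, i < j ∧ φ = box (imp (var (p i)) (dia (var (p j))))}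

end ModalFormula

/-! The idea is an infinitary Löb argument. Suppose that the formulas `□ (p_i → ◇ p_j)` hold at `x`
for the consecutive members of an increasing sequence `i₀ < i₁ < ⋯`, and all on one common punctured
neighbourhood of `x`. On that neighbourhood the union of the extensions of the `p_{i_n}` consists
of limit points of itself, so in a scattered space it must miss a punctured neighbourhood of `x`,
against `◇ p_{i₀}`. Such a sequence exists because the filter of punctured neighbourhoods
in a generalized Icard topology is a union of at most `κ` filters closed under countable
intersections: colour a pair `i < j` by one of these filters that contains the extension of
`p_i → ◇ p_j`, and apply the Erdős–Rado theorem `(2 ^ κ)⁺ → (κ⁺)²_κ`. Finitely many of the formulas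
involve only finitely many variables and so hold in a finite linear order. -/

section ErdosRado

variable {I : Type w} {K : Type u} [LinearOrder I] [WellFoundedLT I]
variable {J : Type*} [LinearOrder J] [WellFoundedLT J] {col : I → I → K} {i j : I} {ξ : J}

/-- The nodes of the end-homogeneous branch below `i` in the Erdős–Rado tree of the colouring `col`
of pairs, enumerated along `J`. The branch reaches `i` where no smaller node is left, and the
disjunct `k = i` keeps it there, so that it is total. -/
noncomputable def branch (col : I → I → K) (i : I) : J → I :=
  WellFoundedLT.fix fun ξ b => wellFounded_lt.min
    {k | k = i ∨ ∀ η (h : η < ξ), b η h < k ∧ col (b η h) k = col (b η h) i} ⟨i, .inl rfl⟩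

theorem branch_eq_min (col : I → I → K) (i : I) (ξ : J) :
    branch col i ξ = wellFounded_lt.min {k | k = i ∨ ∀ η < ξ,
      branch col i η < k ∧ col (branch col i η) k = col (branch col i η) i} ⟨i, .inl rfl⟩ :=
  WellFoundedLT.fix_eq _ ξ

theorem branch_le : branch col i ξ ≤ i := by
  rw [branch_eq_min]
  exact wellFounded_lt.min_le (.inl rfl)

theorem branch_le_of_forall {k : I}
    (h : ∀ η < ξ, branch col i η < k ∧ col (branch col i η) k = col (branch col i η) i) :
    branch col i ξ ≤ k := by
  rw [branch_eq_min]
  exact wellFounded_lt.min_le (.inr h)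

theorem branch_endHomogeneous (h : ∀ η < ξ, branch col i η < i) {η : J} (hη : η < ξ) :
    branch col i η < branch col i ξ ∧
      col (branch col i η) (branch col i ξ) = col (branch col i η) i := by
  obtain hi | hlt := branch_eq_min col i ξ ▸ wellFounded_lt.min_mem {k | k = i ∨ ∀ η < ξ,
    branch col i η < k ∧ col (branch col i η) k = col (branch col i η) i} ⟨i, .inl rfl⟩
  · exact ⟨(h η hη).trans_eq hi.symm, by rw [hi]⟩
  · exact hlt η hη

theorem branch_congr (hi : ∀ η < ξ, branch col i η < i) (hj : ∀ η < ξ, branch col j η < j)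
    (hc : ∀ η < ξ, col (branch col i η) i = col (branch col j η) j) :
    branch col i ξ = branch col j ξ := by
  induction ξ using WellFoundedLT.induction with
  | _ ξ ih =>
    have agree : ∀ η < ξ, branch col i η = branch col j η := fun η hη =>
      ih η hη (fun ζ hζ => hi ζ (hζ.trans hη)) (fun ζ hζ => hj ζ (hζ.trans hη))
        fun ζ hζ => hc ζ (hζ.trans hη)
    refine le_antisymm (branch_le_of_forall fun η hη => ?_) (branch_le_of_forall fun η hη => ?_)
    · rw [hc η hη, agree η hη]
      exact branch_endHomogeneous hj hη
    · rw [← hc η hη, ← agree η hη]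
      exact branch_endHomogeneous hi hη

theorem mk_sigma_Iio_fun_le [Infinite K] {J : Type u} [LinearOrder J] (hJ : #J ≤ 2 ^ #K)
    (hIio : ∀ ξ : J, #(Set.Iio ξ) ≤ #K) : #(Σ ξ : J, Set.Iio ξ → K) ≤ 2 ^ #K := by
  have hK : ℵ₀ ≤ #K := aleph0_le_mk K
  calc #(Σ ξ : J, Set.Iio ξ → K)
      = Cardinal.sum fun ξ : J => #K ^ #(Set.Iio ξ) := by simp
    _ ≤ Cardinal.sum fun _ : J => (2 : Cardinal) ^ #K := sum_le_sum _ _ fun ξ =>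
        (power_le_power_left (mk_ne_zero K) (hIio ξ)).trans (power_self_eq hK).le
    _ = #J * 2 ^ #K := by simp
    _ ≤ 2 ^ #K * 2 ^ #K := by gcongr
    _ = 2 ^ #K := mul_eq_self (hK.trans (cantor _).le)

theorem exists_forall_branch_lt [Infinite K] {J : Type u} [LinearOrder J] [WellFoundedLT J]
    (hJ : #J ≤ 2 ^ #K) (hIio : ∀ ξ : J, #(Set.Iio ξ) ≤ #K)
    (hI : lift.{w} (2 ^ #K) < lift.{u} #I) (col : I → I → K) :
    ∃ i, ∀ ξ : J, branch col i ξ < i := by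
  by_contra! hreach
  have hcode : ∀ i, ∃ c : Σ ξ : J, Set.Iio ξ → K, branch col i c.1 = i ∧
      (∀ η < c.1, branch col i η < i) ∧ c.2 = fun η => col (branch col i η.1) i := by
    intro i
    obtain ⟨ξ, hξ, hmin⟩ := wellFounded_lt.has_min {ξ | i ≤ branch col i ξ} (hreach i)
    exact ⟨⟨ξ, fun η => col (branch col i η.1) i⟩, branch_le.antisymm hξ,
      fun η hη => not_le.1 fun h => hmin η h hη, rfl⟩
  choose code hend hlt hcol using hcode
  have hinj : Function.Injective code := fun i j hij => by
    have hei := hend i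
    have hli := hlt i
    have hci := hcol i
    rw [hij] at hei hli hci
    calc i = branch col i (code j).1 := hei.symm
      _ = branch col j (code j).1 := branch_congr hli (hlt j) fun η hη =>
        congrFun (hci.symm.trans (hcol j)) ⟨η, hη⟩
      _ = j := hend j
  exact hI.not_ge ((lift_mk_le_lift_mk_of_injective hinj).trans
    (lift_le.2 (mk_sigma_Iio_fun_le hJ hIio)))

theorem erdos_rado [Infinite K] (hI : lift.{w} (2 ^ #K) < lift.{u} #I) (col : I → I → K) :
    ∃ (H : Set I) (c : K), lift.{w} #K < lift.{u} #H ∧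
      ∀ i ∈ H, ∀ j ∈ H, i < j → col i j = c := by
  let J := (Order.succ #K).ord.ToType
  have hJ : #J = Order.succ #K := mk_ord_toType _
  obtain ⟨i, hi⟩ := exists_forall_branch_lt (J := J)
    (hJ.trans_le (Order.succ_le_of_lt (cantor _)))
    (fun ξ => Order.lt_succ_iff.1 ((mk_Iio_lt ξ (by simp [J])).trans_eq hJ)) hI col
  have hmono : StrictMono fun ξ : J => branch col i ξ :=
    fun _ _ h => (branch_endHomogeneous (fun ζ _ => hi ζ) h).1
  have hKJ : #K < #J := hJ ▸ Order.lt_succ _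
  obtain ⟨c, hc⟩ := infinite_pigeonhole_card_lt (fun ξ : J => col (branch col i ξ) i) hKJ
    ((aleph0_le_mk K).trans hKJ.le)
  refine ⟨branch col i '' {ξ : J | col (branch col i ξ) i = c}, c, ?_, ?_⟩
  · rw [mk_image_eq_lift _ _ hmono.injective]
    exact lift_lt.2 hc
  · rintro _ ⟨η, hη, rfl⟩ _ ⟨ξ, -, rfl⟩ h
    rw [(branch_endHomogeneous (fun ζ _ => hi ζ) (hmono.lt_iff_lt.1 h)).2]
    exact hη

theorem exists_strictMono_nat_of_infinite (α : Type*) [LinearOrder α] [WellFoundedLT α]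
    [Infinite α] : ∃ f : ℕ → α, StrictMono f := by
  obtain ⟨f, hf | hf⟩ := Infinite.exists_strictMono_or_strictAnti α
  · exact ⟨f, hf⟩
  · exact absurd hf (not_strictAnti_of_wellFoundedLT f)

end ErdosRado

section SigmaUnion

open Filter

variable {X : Type w} {K : Type u} {l : Filter X}

theorem countableInterFilter_biInf_finset {ι : Type*} {G : ι → Filter X} (t : Finset ι)
    (hG : ∀ i, CountableInterFilter (G i)) : CountableInterFilter (⨅ i ∈ t, G i) := by
  classical
  induction t using Finset.induction_on with
  | empty => simpa using countableInterFilter_top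
  | insert i t _ ih =>
    rw [Finset.iInf_insert]
    exact countableInterFilter_inf _ _

/-- The filter `l` is the union of a family, indexed by `K`, of filters that are closed under
countable intersections. -/
def IsSigmaUnion (K : Type u) (l : Filter X) : Prop :=
  ∃ G : K → Filter X, (∀ k, CountableInterFilter (G k)) ∧ ∀ U, U ∈ l ↔ ∃ k, U ∈ G k

namespace IsSigmaUnion

theorem of_countableInterFilter [Nonempty K] [CountableInterFilter l] : IsSigmaUnion K l :=
  ⟨fun _ => l, fun _ => inferInstance, by simp⟩

theorem mono {J : Type v} (h : IsSigmaUnion J l) (hJK : lift.{u} #J ≤ lift.{v} #K) :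
    IsSigmaUnion K l := by
  obtain ⟨G, hG, hmem⟩ := h
  obtain ⟨e⟩ := lift_mk_le'.1 hJK
  have : Nonempty J := ((hmem _).1 univ_mem).nonempty
  refine ⟨G ∘ Function.invFun e, fun k => hG _, fun U => (hmem U).trans ?_⟩
  exact (Function.invFun_surjective e.injective).exists

theorem iInf [Infinite K] {ι : Type v} (hι : lift.{u} #ι ≤ lift.{v} #K) {l : ι → Filter X}
    (h : ∀ i, IsSigmaUnion K (l i)) : IsSigmaUnion K (⨅ i, l i) := by
  choose G hG hmem using h
  have hiInf (i : ι) : l i = ⨅ k, G i k :=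
    le_antisymm (le_iInf fun k _ hU => (hmem i _).2 ⟨k, hU⟩) fun U hU =>
      have ⟨k, hk⟩ := (hmem i U).1 hU
      mem_iInf_of_mem k hk
  have hfin : IsSigmaUnion (Finset (ι × K)) (⨅ i, l i) := by
    refine ⟨fun t => ⨅ q ∈ t, G q.1 q.2,
      fun t => countableInterFilter_biInf_finset t fun q => hG q.1 q.2, fun U => ?_⟩
    rw [iInf_congr hiInf, iInf_prod']
    exact mem_iInf_finite U
  obtain ⟨e⟩ := lift_mk_le'.1 hι
  refine hfin.mono ?_
  calc lift.{u} #(Finset (ι × K))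
      ≤ lift.{max v u} #(Finset (K × K)) :=
        lift_mk_le_lift_mk_of_injective (Finset.map_injective (e.prodMap (.refl K)))
    _ = lift.{max v u} #K := by simp [mk_finset_of_infinite, mul_eq_self (aleph0_le_mk K)]

theorem inf [Infinite K] {l₁ l₂ : Filter X} (h₁ : IsSigmaUnion K l₁) (h₂ : IsSigmaUnion K l₂) :
    IsSigmaUnion K (l₁ ⊓ l₂) := by
  rw [inf_eq_iInf]
  exact .iInf ((lift_le_aleph0.2 mk_le_aleph0).trans (aleph0_le_lift.2 (aleph0_le_mk K)))
    (Bool.forall_bool.2 ⟨h₂, h₁⟩)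

theorem iInf_principal [Infinite K] {A : Type*} [LinearOrder A] [Nonempty A] {W : A → Set X}
    (hW : Antitone W) : IsSigmaUnion K (⨅ a, 𝓟 (W a)) := by
  have mem_iff (U : Set X) : U ∈ ⨅ a, 𝓟 (W a) ↔ ∃ a, W a ⊆ U := by
    simpa using (hasBasis_iInf_principal hW.directed_ge).mem_iff (t := U)
  by_cases hcof : ∃ f : K → A, ∀ a, ∃ k, a ≤ f k
  · obtain ⟨f, hf⟩ := hcof
    refine ⟨fun k => 𝓟 (W (f k)), fun k => inferInstance, fun U => (mem_iff U).trans ?_⟩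
    exact ⟨fun ⟨a, ha⟩ => (hf a).imp fun k hk => (hW hk).trans ha, fun ⟨k, hk⟩ => ⟨f k, hk⟩⟩
  · push Not at hcof
    have : CountableInterFilter (⨅ a, 𝓟 (W a)) := by
      refine ⟨fun S hS hSl => ?_⟩
      have := hS.to_subtype
      obtain ⟨e, he⟩ := exists_injective_nat S
      choose a ha using fun U : S => (mem_iff U).1 (hSl U U.2)
      have hinj := (Infinite.natEmbedding K).injective.comp he
      obtain ⟨b, hb⟩ := hcof (Function.extend _ a fun _ => Classical.arbitrary A)
      refine (mem_iff _).2 ⟨b, Set.subset_sInter fun U hU => (hW ?_).trans (ha ⟨U, hU⟩)⟩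
      exact hinj.extend_apply a _ ⟨U, hU⟩ ▸ (hb _).le
    exact of_countableInterFilter

theorem exists_iInter_mem {I : Type v} [LinearOrder I] [WellFoundedLT I] [Infinite K]
    (hl : IsSigmaUnion K l) (hI : lift.{v} (2 ^ #K) < lift.{u} #I) {U : I → I → Set X}
    (hU : ∀ i j, i < j → U i j ∈ l) :
    ∃ f : ℕ → I, StrictMono f ∧ ⋂ n, U (f n) (f (n + 1)) ∈ l := by
  obtain ⟨G, hG, hmem⟩ := hl
  simp only [hmem] at hU ⊢
  choose! col hcol using hU
  obtain ⟨H, c, hH, hc⟩ := erdos_rado hI col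
  have : Infinite H := by
    have hK : ℵ₀ ≤ lift.{v} #K := aleph0_le_lift.2 (aleph0_le_mk K)
    exact infinite_iff.2 (aleph0_le_lift.1 (hK.trans hH.le))
  obtain ⟨f, hf⟩ := exists_strictMono_nat_of_infinite H
  refine ⟨fun n => f n, hf, c, countable_iInter_mem.2 fun n => ?_⟩
  have hlt : (f n : I) < f (n + 1) := hf n.lt_succ_self
  exact hc _ (f n).2 _ (f (n + 1)).2 hlt ▸ hcol _ _ hlt

end IsSigmaUnion

end SigmaUnion

section Scattered

open Filter Topology

variable {X : Type w} {τ : TopologicalSpace X} {x : X}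

/-- Scattered topologies, the topological models of `GL`: no nonempty set consists of limit points
of itself. The condition is stated for `Preperfect` sets because `A` need not be closed. -/
def IsScattered (τ : TopologicalSpace X) : Prop :=
  ∀ A : Set X, @Preperfect X τ A → A = ∅

namespace IsScattered

theorem mono {σ : TopologicalSpace X} (h : σ ≤ τ) (hτ : IsScattered τ) : IsScattered σ :=
  fun A hA => hτ A fun x hx => NeBot.mono (hA x hx)
    (inf_le_inf_right _ (inf_le_inf_right _ (nhds_mono h)))

theorem of_wellFounded {r : X → X → Prop} (hr : WellFounded r)
    (h : ∀ x, ∀ᶠ y in 𝓝[≠] x, r y x) : IsScattered τ := by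
  intro A hA
  by_contra! hne
  obtain ⟨x, hx, hmin⟩ := hr.has_min A hne
  obtain ⟨y, hyA, hyx⟩ := ((accPt_iff_frequently_nhdsNE.1 (hA x hx)).and_eventually (h x)).exists
  exact hmin y hyA hyx

theorem of_isOpen_Iic [PartialOrder X] [WellFoundedLT X] (h : ∀ y : X, IsOpen (Set.Iic y)) :
    IsScattered τ :=
  of_wellFounded wellFounded_lt fun x => by
    filter_upwards [mem_nhdsWithin_of_mem_nhds ((h x).mem_nhds Set.self_mem_Iic),
      self_mem_nhdsWithin] with y hyx hne
    exact lt_of_le_of_ne hyx hne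

theorem eventually_notMem (hτ : IsScattered τ) {A : Set X}
    (h : ∀ᶠ y in 𝓝[≠] x, y ∈ A → AccPt y (𝓟 A)) : ∀ᶠ y in 𝓝[≠] x, y ∉ A := by
  by_contra hfreq
  have hx : AccPt x (𝓟 A) := accPt_iff_frequently_nhdsNE.2 hfreq
  obtain ⟨U, hU, hxU, hUA⟩ := mem_nhdsWithin.1 h
  have hpre : Preperfect (U ∩ insert x A) := by
    rintro y ⟨hyU, hy⟩
    have hyA : AccPt y (𝓟 A) := by
      obtain rfl | hne := eq_or_ne y x
      · exact hx
      · exact hUA ⟨hyU, hne⟩ (hy.resolve_left hne)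
    exact (hyA.mono (principal_mono.2 (Set.subset_insert x A))).nhds_inter (hU.mem_nhds hyU)
  exact Set.notMem_empty x (hτ _ hpre ▸ ⟨hxU, Set.mem_insert x A⟩)

end IsScattered

theorem nhdsNE_upperSet [PartialOrder X] (x : X) :
    @nhdsWithin X (upperSet X) x {x}ᶜ = 𝓟 (Set.Ioi x) := by
  let := upperSet X
  have : Topology.IsUpperSet X := ⟨rfl⟩
  rw [nhdsWithin, IsUpperSet.nhds_eq_principal_Ici, inf_principal, ← Set.sdiff_eq,
    Set.Ici_sdiff_left]

theorem isScattered_upperSet [PartialOrder X] [WellFoundedGT X] : IsScattered (upperSet X) :=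
  .of_wellFounded (r := (· > ·)) wellFounded_gt fun x => by
    rw [nhdsNE_upperSet]
    exact eventually_principal.2 fun _ => id

end Scattered

namespace ModalFormula

open Filter Topology

section Soundness

variable {P : Type v} {X : Type w} {τ : TopologicalSpace X} {V : P → Set X} {x : X}
variable {φ ψ : ModalFormula P} {Γ : Set (ModalFormula P)}

theorem mem_truthSet_imp :
    x ∈ truthSet τ V (imp φ ψ) ↔ (x ∈ truthSet τ V φ → x ∈ truthSet τ V ψ) := by
  simp [imp, truthSet]

theorem mem_truthSet_dia :
    x ∈ truthSet τ V (dia φ) ↔ ∃ᶠ y in 𝓝[≠] x, y ∈ truthSet τ V φ := by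
  rw [truthSet_dia, mem_derivedSet, accPt_iff_frequently_nhdsNE]

theorem mem_truthSet_box :
    x ∈ truthSet τ V (box φ) ↔ ∀ᶠ y in 𝓝[≠] x, y ∈ truthSet τ V φ := by
  simp [truthSet, mem_derivedSet, accPt_iff_frequently_nhdsNE]

theorem GLProvable.mem_truthSet (h : GLProvable φ) (hτ : IsScattered τ) (V : P → Set X) (x : X) :
    x ∈ truthSet τ V φ := by
  induction h generalizing x with
  | taut _ h => exact h (fun ψ => x ∈ truthSet τ V ψ) (fun _ => Iff.rfl) fun _ _ => Iff.rfl
  | axK φ ψ =>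
    simp only [mem_truthSet_imp, mem_truthSet_box]
    exact fun hφψ hφ => hφψ.mp (hφ.mono fun _ h hφψ => hφψ h)
  | axLob φ =>
    simp only [mem_truthSet_imp, mem_truthSet_box]
    intro hlob
    have hacc : ∀ᶠ y in 𝓝[≠] x, y ∈ (truthSet τ V φ)ᶜ → AccPt y (𝓟 (truthSet τ V φ)ᶜ) :=
      hlob.mono fun y hy hyφ => accPt_iff_frequently_nhdsNE.2 fun h => hyφ (hy (by simpa using h))
    exact (hτ.eventually_notMem hacc).mono fun _ => not_not.1
  | mp φ ψ _ _ ihφψ ihφ => exact mem_truthSet_imp.1 (ihφψ x) (ihφ x)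
  | nec φ _ ih => exact mem_truthSet_box.2 (.of_forall ih)

theorem mem_truthSet_foldr_imp {l : List (ModalFormula P)} :
    x ∈ truthSet τ V (l.foldr imp φ) ↔
      ((∀ γ ∈ l, x ∈ truthSet τ V γ) → x ∈ truthSet τ V φ) := by
  induction l with
  | nil => simp
  | cons γ l ih => simp [mem_truthSet_imp, ih]

theorem Derives.mem_truthSet (h : Derives Γ φ) (hτ : IsScattered τ)
    (hx : ∀ γ ∈ Γ, x ∈ truthSet τ V γ) : x ∈ truthSet τ V φ := by
  obtain ⟨l, hl, hφ⟩ := h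
  exact mem_truthSet_foldr_imp.1 (hφ.mem_truthSet hτ V x) fun γ hγ => hx γ (hl γ hγ)

theorem SatisfiableOn.consistent (h : SatisfiableOn τ Γ) (hτ : IsScattered τ) :
    Consistent Γ := by
  obtain ⟨V, x, hx⟩ := h
  rintro ⟨φ, hφ, hneg⟩
  exact hneg.mem_truthSet hτ hx (hφ.mem_truthSet hτ hx)

theorem Derives.mono {Δ : Set (ModalFormula P)} (h : Derives Γ φ) (hΓ : Γ ⊆ Δ) : Derives Δ φ :=
  h.imp fun _ hl => ⟨fun γ hγ => hΓ (hl.1 γ hγ), hl.2⟩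

theorem Derives.exists_of_iUnion {ι : Type*} [Nonempty ι] {Γ : ι → Set (ModalFormula P)}
    (hΓ : Directed (· ⊆ ·) Γ) (h : Derives (⋃ i, Γ i) φ) : ∃ i, Derives (Γ i) φ := by
  obtain ⟨l, hl, hφ⟩ := h
  obtain ⟨i, hi⟩ := hΓ.exists_mem_subset_of_finset_subset_biUnion
    (s := l.finite_toSet.toFinset) (by simpa [Set.subset_def] using hl)
  exact ⟨i, l, by simpa [Set.subset_def] using hi, hφ⟩

theorem consistent_iUnion_of_directed {ι : Type*} [Nonempty ι] {Γ : ι → Set (ModalFormula P)}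
    (hΓ : Directed (· ⊆ ·) Γ) (h : ∀ i, Consistent (Γ i)) : Consistent (⋃ i, Γ i) := by
  rintro ⟨φ, hφ, hneg⟩
  obtain ⟨i, hi⟩ := hφ.exists_of_iUnion hΓ
  obtain ⟨j, hj⟩ := hneg.exists_of_iUnion hΓ
  obtain ⟨k, hik, hjk⟩ := hΓ i j
  exact h k ⟨φ, hi.mono hik, hj.mono hjk⟩

end Soundness

section ChainSet

variable {P : Type v}

theorem chainSet_comp_subset {I J : Type*} [Preorder I] [Preorder J] {p : I → P} {f : J → I}
    (hf : StrictMono f) :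
    chainSet (p ∘ f) ⊆ chainSet p := by
  rintro _ (⟨i, rfl⟩ | ⟨i, j, hij, rfl⟩)
  · exact .inl ⟨f i, rfl⟩
  · exact .inr ⟨f i, f j, hf hij, rfl⟩

variable {I : Type w} [PartialOrder I] {p : I → P}

theorem satisfiableOn_upperSet_chainSet (hp : Function.Injective p) :
    SatisfiableOn (upperSet (WithBot I)) (chainSet p) := by
  refine ⟨fun q => {x | ∃ i : I, x = i ∧ p i = q}, ⊥, ?_⟩
  rintro _ (⟨i, rfl⟩ | ⟨i, j, hij, rfl⟩)
  · rw [mem_truthSet_dia, nhdsNE_upperSet, frequently_principal]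
    exact ⟨i, WithBot.bot_lt_coe i, i, rfl, rfl⟩
  · rw [mem_truthSet_box]
    refine .of_forall fun x => mem_truthSet_imp.2 ?_
    rintro ⟨k, rfl, hk⟩
    obtain rfl : k = i := hp hk
    rw [mem_truthSet_dia, nhdsNE_upperSet, frequently_principal]
    exact ⟨j, WithBot.coe_lt_coe.2 hij, j, rfl, rfl⟩

theorem consistent_chainSet (hp : Function.Injective p) : Consistent (chainSet p) := by
  classical
  have hfin (J : Finset I) : Consistent (chainSet (p ∘ ((↑) : J → I))) :=
    (satisfiableOn_upperSet_chainSet (hp.comp Subtype.val_injective)).consistent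
      isScattered_upperSet
  have hmono {J J' : Finset I} (h : J ⊆ J') :
      chainSet (p ∘ ((↑) : J → I)) ⊆ chainSet (p ∘ ((↑) : J' → I)) :=
    chainSet_comp_subset (p := p ∘ ((↑) : J' → I)) (f := Set.inclusion h) fun _ _ => id
  have hunion : chainSet p = ⋃ J : Finset I, chainSet (p ∘ ((↑) : J → I)) := by
    refine Set.Subset.antisymm ?_ (Set.iUnion_subset fun J => chainSet_comp_subset fun _ _ => id)
    rintro _ (⟨i, rfl⟩ | ⟨i, j, hij, rfl⟩)
    · exact Set.mem_iUnion.2 ⟨{i}, .inl ⟨⟨i, by simp⟩, rfl⟩⟩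
    · exact Set.mem_iUnion.2 ⟨{i, j}, .inr ⟨⟨i, by simp⟩, ⟨j, by simp⟩, hij, rfl⟩⟩
  rw [hunion]
  exact consistent_iUnion_of_directed (directed_of_isDirected_le fun _ _ => hmono) hfin

end ChainSet

section Nonsatisfiability

variable {P : Type v} {X : Type w} {K : Type u} {τ : TopologicalSpace X}

theorem not_satisfiableOn_chainSet (hτ : IsScattered τ) [Infinite K]
    (hK : ∀ x : X, IsSigmaUnion K (𝓝 x)) {I : Type*} [LinearOrder I] [WellFoundedLT I]
    (hI : lift (2 ^ #K) < lift.{u} #I) (p : I → P) : ¬ SatisfiableOn τ (chainSet p) := by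
  rintro ⟨V, x, hx⟩
  have hdia (i) : ∃ᶠ y in 𝓝[≠] x, y ∈ V (p i) := mem_truthSet_dia.1 (hx _ (.inl ⟨i, rfl⟩))
  have hbox (i j) (hij : i < j) : {y | y ∈ V (p i) → AccPt y (𝓟 (V (p j)))} ∈ 𝓝[≠] x := by
    filter_upwards [mem_truthSet_box.1 (hx _ (.inr ⟨i, j, hij, rfl⟩))] with y hy hyi
    exact accPt_iff_frequently_nhdsNE.2 (mem_truthSet_dia.1 (mem_truthSet_imp.1 hy hyi))
  have hl : IsSigmaUnion K (𝓝[≠] x) := (hK x).inf .of_countableInterFilter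
  obtain ⟨f, -, hf⟩ := hl.exists_iInter_mem hI hbox
  have hself : ∀ᶠ y in 𝓝[≠] x, y ∈ ⋃ n, V (p (f n)) → AccPt y (𝓟 (⋃ n, V (p (f n)))) := by
    filter_upwards [hf] with y hy hyV
    obtain ⟨n, hn⟩ := Set.mem_iUnion.1 hyV
    exact (Set.mem_iInter.1 hy n hn).mono (principal_mono.2 (Set.subset_iUnion_of_subset _ le_rfl))
  obtain ⟨y, hy, hnot⟩ := ((hdia (f 0)).and_eventually (hτ.eventually_notMem hself)).exists
  exact hnot (Set.mem_iUnion_of_mem 0 hy)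

end Nonsatisfiability

end ModalFormula

section Icard

open Filter Topology

variable {X : Type w} {τ : TopologicalSpace X} {lam : Ordinal.{u}}

theorem hyperlog_le (ξ a : Ordinal.{u}) : hyperlog ξ a ≤ a :=
  (isHyperlog_hyperlog.initial ξ).le a

theorem icardInterval_mono {ξ : Ordinal.{u}} {a b : WithBot Ordinal.{u}} {c d : Ordinal.{u}}
    (hab : b ≤ a) (hcd : c ≤ d) : icardInterval τ ξ a c ⊆ icardInterval τ ξ b d :=
  fun _ hy => ⟨hab.trans_lt hy.1, hy.2.trans hcd⟩

theorem genIcard_le (τ : TopologicalSpace X) (lam : Ordinal.{u}) : genIcard τ lam ≤ τ :=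
  fun _ hU => .basic _ (.inl hU)

theorem pointRank_lt_spaceRank [Small.{u} X] (τ : TopologicalSpace X) (x : X) :
    (pointRank τ x : Ordinal.{u}) < spaceRank τ :=
  Order.add_one_le_iff.1 (Ordinal.le_iSup (fun x => pointRank τ x + 1) x)

theorem nhds_genIcard [Small.{u} X] (τ : TopologicalSpace X) (lam : Ordinal.{u}) (x : X) :
    @nhds X (genIcard τ lam) x = 𝓝 x ⊓
      ⨅ ξ : Set.Iio lam, ⨅ a : {a : WithBot Ordinal.{u} // a < hyperlog ξ (pointRank τ x)},
        𝓟 (icardInterval τ ξ a (hyperlog ξ (pointRank τ x))) := by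
  refine le_antisymm (le_inf (nhds_mono (genIcard_le τ lam)) (le_iInf₂ fun ξ a => ?_)) ?_
  · have hle : hyperlog ξ (pointRank τ x) ≤ spaceRank τ :=
      (hyperlog_le _ _).trans (pointRank_lt_spaceRank τ x).le
    exact le_principal_iff.2 (@IsOpen.mem_nhds _ (genIcard τ lam) x _
      (.basic _ (.inr ⟨ξ, ξ.2, a, _, a.2, hle, rfl⟩)) ⟨a.2, le_rfl⟩)
  · rw [TopologicalSpace.nhds_generateFrom]
    refine le_iInf₂ ?_
    rintro s ⟨hx, hs | ⟨ξ, hξ, a, b, -, -, rfl⟩⟩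
    · exact inf_le_left.trans (le_principal_iff.2 (hs.mem_nhds hx))
    · exact inf_le_right.trans ((iInf₂_le (⟨ξ, hξ⟩ : Set.Iio lam) ⟨a, hx.1⟩).trans
        (principal_mono.2 (icardInterval_mono le_rfl hx.2)))

theorem isSigmaUnion_nhds_genIcard [Small.{u} X] {K : Type u} [Infinite K] (hK : lam.card ≤ #K)
    (x : X) [CountableInterFilter (𝓝 x)] : IsSigmaUnion K (@nhds X (genIcard τ lam) x) := by
  rw [nhds_genIcard]
  refine .inf .of_countableInterFilter (.iInf ?_ fun ξ => ?_)
  · calc lift.{u} #(Set.Iio lam) = lift.{u + 1} lam.card := by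
          rw [Cardinal.lift_id'.{u, u + 1}, Cardinal.mk_Iio_ordinal]
      _ ≤ lift.{u + 1} #K := Cardinal.lift_le.2 hK
  · have : Nonempty {a : WithBot Ordinal.{u} // a < hyperlog ξ (pointRank τ x)} :=
      ⟨⟨⊥, WithBot.bot_lt_coe _⟩⟩
    exact .iInf_principal fun a b hab => icardInterval_mono hab le_rfl

theorem countableInterFilter_nhds
    (h : ∀ S : Set (Set X), S.Countable → (∀ U ∈ S, IsOpen U) → IsOpen (⋂₀ S)) (x : X) :
    CountableInterFilter (𝓝 x) := by
  refine ⟨fun S hS hmem => ?_⟩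
  choose! V hVU hV hx using fun U hU => mem_nhds_iff.1 (hmem U hU)
  refine mem_nhds_iff.2 ⟨⋂₀ (V '' S), Set.subset_sInter fun U hU => ?_,
    h _ (hS.image V) (Set.forall_mem_image.2 hV), Set.mem_sInter.2 (Set.forall_mem_image.2 hx)⟩
  exact (Set.sInter_subset_of_mem (Set.mem_image_of_mem V hU)).trans (hVU U hU)

end Icard

section OrdinalTopologies

open Filter

variable {Θ : Ordinal.{u}}

theorem isScattered_leftTopology : IsScattered (leftTopology Θ) :=
  .of_isOpen_Iic fun y => .basic _ ⟨y, rfl⟩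

theorem nhds_leftTopology (x : Set.Iio Θ) : @nhds _ (leftTopology Θ) x = 𝓟 (Set.Iic x) := by
  rw [TopologicalSpace.nhds_generateFrom]
  refine le_antisymm (iInf₂_le _ ⟨Set.self_mem_Iic, x, rfl⟩) (le_iInf₂ ?_)
  rintro _ ⟨hx, b, rfl⟩
  exact principal_mono.2 (Set.Iic_subset_Iic.2 hx)

theorem isScattered_clubTopology : IsScattered (clubTopology Θ) :=
  .of_isOpen_Iic fun _ α hα _ =>
    ⟨Set.univ, IsClub.univ, fun γ h _ => (show γ < α from h).le.trans hα⟩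

theorem isOpen_clubTopology_sInter (S : Set (Set (Set.Iio Θ))) (hS : S.Countable)
    (h : ∀ U ∈ S, @IsOpen _ (clubTopology Θ) U) : @IsOpen _ (clubTopology Θ) (⋂₀ S) := by
  intro α hα hcof
  have := hS.to_subtype
  choose C hC hCU using fun U : S => h U U.2 α (hα U U.2) hcof
  have hcof' : Order.cof (Set.Iio α.1) ≠ ℵ₀ := by
    rw [Ordinal.cof_Iio, ← Ordinal.lift_cof]
    exact mt Cardinal.lift_eq_aleph0.1 hcof.ne'
  exact ⟨⋂ U, C U, .iInter_of_countable hcof' hC, fun γ hγ hmem U hU =>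
    hCU ⟨U, hU⟩ γ hγ (Set.mem_iInter.1 hmem ⟨U, hU⟩)⟩

end OrdinalTopologies

section Main

open ModalFormula

/-- The spaces `(X, τ_{+lam})` with `τ` a scattered topology whose neighbourhood filters are closed
under countable intersections. Smallness of `X` keeps the supremum `spaceRank τ`, which bounds the
Icard intervals, from taking its junk value. -/
def genIcardClass (lam : Ordinal.{u}) : Set (Σ X : Type w, TopologicalSpace X) :=
  {S | ∃ τ : TopologicalSpace S.1, Small.{u} S.1 ∧ IsScattered τ ∧
    (∀ x, CountableInterFilter (@nhds S.1 τ x)) ∧ S.2 = genIcard τ lam}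

theorem icardTopology_mem_genIcardClass (Θ lam : Ordinal.{u}) :
    ⟨Set.Iio Θ, icardTopology Θ lam⟩ ∈ genIcardClass lam := by
  refine ⟨leftTopology Θ, inferInstance, isScattered_leftTopology, fun x => ?_, rfl⟩
  rw [nhds_leftTopology]
  infer_instance

theorem genIcard_clubTopology_mem_genIcardClass (Θ lam : Ordinal.{u}) :
    ⟨Set.Iio Θ, genIcard (clubTopology Θ) lam⟩ ∈ genIcardClass lam :=
  ⟨clubTopology Θ, inferInstance, isScattered_clubTopology,
    @countableInterFilter_nhds _ (clubTopology Θ) isOpen_clubTopology_sInter, rfl⟩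

theorem not_satisfiableOn_chainSet_of_mem_genIcardClass {lam : Ordinal.{u}} {I : Type*}
    [LinearOrder I] [WellFoundedLT I] (hI : lift (2 ^ (lam.card + ℵ₀)) < lift.{u} #I)
    {P : Type v} (p : I → P) {S : Σ X : Type w, TopologicalSpace X} (hS : S ∈ genIcardClass lam) :
    ¬ SatisfiableOn S.2 (chainSet p) := by
  obtain ⟨τ, _, hτ, hτω, hS⟩ := hS
  have hK : #(lam.card + ℵ₀).out = lam.card + ℵ₀ := mk_out _
  have : Infinite (lam.card + ℵ₀).out := infinite_iff.2 (le_add_self.trans_eq hK.symm)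
  rw [hS]
  exact not_satisfiableOn_chainSet (hτ.mono (genIcard_le τ lam))
    (fun x => isSigmaUnion_nhds_genIcard (le_self_add.trans_eq hK.symm) x) (hK.symm ▸ hI) p

theorem theorem1_general (lam : Ordinal.{u}) {I : Type*} [LinearOrder I] [WellFoundedLT I]
    (hI : lift (2 ^ (lam.card + ℵ₀)) < lift.{u} #I) {P : Type v} {p : I → P}
    (hp : Function.Injective p) :
    Consistent (chainSet p) ∧
    (∀ S ∈ genIcardClass.{u, w} lam, ¬ SatisfiableOn S.2 (chainSet p)) ∧
    ∀ C ⊆ genIcardClass.{u, w} lam, ¬ StronglyComplete P C := by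
  have hsat (S) (hS : S ∈ genIcardClass lam) : ¬ SatisfiableOn S.2 (chainSet p) :=
    not_satisfiableOn_chainSet_of_mem_genIcardClass hI p hS
  refine ⟨consistent_chainSet hp, hsat, fun C hC hcomplete => ?_⟩
  obtain ⟨S, hS, h⟩ := hcomplete _ (consistent_chainSet hp)
  exact hsat S (hC hS) h

end Main

theorem theorem1 (lam : Ordinal.{u}) (P : Type v)
    (p : Set.Iio (Order.succ ((2 : Cardinal.{u}) ^ (lam.card + ℵ₀))).ord ≃ P) :
    ModalFormula.Consistent (ModalFormula.chainSet p) ∧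
    (∀ Θ : Ordinal.{u},
      ¬ ModalFormula.SatisfiableOn (icardTopology Θ lam) (ModalFormula.chainSet p)) ∧
    (∀ Θ : Ordinal.{u},
      ¬ ModalFormula.SatisfiableOn (genIcard (clubTopology Θ) lam) (ModalFormula.chainSet p)) ∧
    (∀ K : Set (Σ X : Type (u + 1), TopologicalSpace X),
      (∀ S ∈ K, ∃ Θ : Ordinal.{u},
        S = ⟨Set.Iio Θ, icardTopology Θ lam⟩ ∨ S = ⟨Set.Iio Θ, genIcard (clubTopology Θ) lam⟩) →
      ¬ ModalFormula.StronglyComplete P K) := by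
  have hI : lift.{u + 1} ((2 : Cardinal.{u}) ^ (lam.card + ℵ₀)) <
      lift.{u} #(Set.Iio (Order.succ ((2 : Cardinal.{u}) ^ (lam.card + ℵ₀))).ord) := by
    simp [Cardinal.mk_Iio_ordinal]
  obtain ⟨hcons, hsat, hcomplete⟩ := theorem1_general lam hI p.injective
  refine ⟨hcons, fun Θ => hsat _ (icardTopology_mem_genIcardClass Θ lam),
    fun Θ => hsat _ (genIcard_clubTopology_mem_genIcardClass Θ lam),
    fun K hK => hcomplete K fun S hS => ?_⟩
  obtain ⟨Θ, rfl | rfl⟩ := hK S hS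
  · exact icardTopology_mem_genIcardClass Θ lam
  · exact genIcard_clubTopology_mem_genIcardClass Θ lam
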